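/- Let $\tau\neq 0$ and let $\mathrm{Nil}_3(\tau)$ be $\mathbb{R}^3$ with the Riemannian metric for which $E_1=\partial_x-\tau y\,\partial_z$, $E_2=\partial_y+\tau x\,\partial_z$, $E_3=\partial_z$ is an orthonormal frame. For $\theta\in\mathbb{R}$ let $\Sigma_\theta\subset\mathrm{Nil}_3(\tau)$ be the (Figueroa–Mercuri–Pedrosa) entire graph $z=f_\theta(x,y)$, $(x,y)\in\mathbb{R}^2$, of $$f_\theta(x,y)=\tau xy+\frac{\sinh\theta}{4\tau}\left[2\tau y\sqrt{1+4\tau^2y^2}+\operatorname{arcsinh}(2\tau y)\right],$$ with the induced metric. Its mean curvature as a graph is $H(u)=\frac12\operatorname{div}\bigl(Gu/\sqrt{1+|Gu|^2}\bigr)$ with $u=f_\theta$ and $Gu=(u_x+\tau y)\partial_x+(u_y-\tau x)\partial_y$, the divergence and norm being those of $\mathbb{R}^2$. Then $\Sigma_\theta$ is minimal, i.e. $H(f_\theta)=0$ on $\mathbb{R}^2$, and: (a) $\Sigma_\theta$ has exactly cubic extrinsic and intrinsic area growth. That is, for every $p_0\in\mathrm{Nil}_3(\tau)$, if $B_R(p_0)$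 is the geodesic ball of $\mathrm{Nil}_3(\tau)$ of radius $R$ centered at $p_0$, then $$0<\liminf_{R\to\infty}\frac{\operatorname{area}(\Sigma_\theta\cap B_R(p_0))}{R^3}\quad\text{and}\quad\limsup_{R\to\infty}\frac{\operatorname{area}(\Sigma_\theta\cap B_R(p_0))}{R^3}<\infty,$$ and, for every $p_0\in\Sigma_\theta$, the same two inequalities hold for the area of the geodesic ball of $\Sigma_\theta$ of radius $R$ centered at $p_0$, with respect to the intrinsic distance of $\Sigma_\theta$. (b) $\Sigma_\theta$ is globally conformal to $\mathbb{C}$: there is a conformal diffeomorphism from $\mathbb{C}$ onto $\Sigma_\theta$. Moreover $\Sigma_\theta$ is parabolic: every non-positive $C^2$ function $u$ on $\Sigma_\theta$ with $\Delta_{\Sigma_\theta}u\geq 0$ is constant. -/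

import Mathlib

open Set Filter MeasureTheory
open scoped ENNReal ContDiff

namespace HeisenbergGraphs

/-- The underlying manifold of `Nil₃(τ)`: points `(x, y, z)` of `ℝ³`, in the global chart.
The same type is used for tangent vectors `v.1 ∂x + v.2.1 ∂y + v.2.2 ∂z`.
(Only the smooth structure of this product is used, never its sup distance.) -/
abbrev Pt : Type := ℝ × ℝ × ℝ

/-- The frame field `E₁ = ∂x - τ y ∂z`. -/
def frame₁ (τ : ℝ) (p : Pt) : Pt := (1, 0, -(τ * p.2.1))

/-- The frame field `E₂ = ∂y + τ x ∂z`. -/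
def frame₂ (τ : ℝ) (p : Pt) : Pt := (0, 1, τ * p.1)

/-- The frame field `E₃ = ∂z`. -/
def frame₃ (_p : Pt) : Pt := (0, 0, 1)

/-- The coefficient of `E₃` in the expansion of the tangent vector `v` at `p` in the frame
`E₁, E₂, E₃`. The coefficients of `E₁` and `E₂` are `v.1` and `v.2.1`. -/
def vert (τ : ℝ) (p v : Pt) : ℝ := v.2.2 + τ * (p.2.1 * v.1 - p.1 * v.2.1)

theorem frame_expansion (τ : ℝ) (p v : Pt) :
    v = v.1 • frame₁ τ p + v.2.1 • frame₂ τ p + vert τ p v • frame₃ p := by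
  refine Prod.ext ?_ (Prod.ext ?_ ?_)
  · simp [frame₁, frame₂, frame₃]
  · simp [frame₁, frame₂, frame₃]
  · simp only [frame₁, frame₂, frame₃, vert, Prod.snd_add, Prod.smul_snd, smul_eq_mul]
    ring

/-- The Riemannian metric of `Nil₃(τ)`: the inner product of the tangent vectors `v`, `w` at `p`
for which `E₁, E₂, E₃` is orthonormal. -/
def metric (τ : ℝ) (p v w : Pt) : ℝ :=
  v.1 * w.1 + v.2.1 * w.2.1 + vert τ p v * vert τ p w

/-- The length in `Nil₃(τ)` of a curve `γ` parametrized by `[0, 1]`. -/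
noncomputable def curveLength (τ : ℝ) (γ : ℝ → Pt) : ℝ≥0∞ :=
  ∫⁻ t in Icc (0 : ℝ) 1, ENNReal.ofReal (Real.sqrt
    (metric τ (γ t) (derivWithin γ (Icc 0 1) t) (derivWithin γ (Icc 0 1) t)))

/-- The infimum of the lengths of the `C¹` curves from `p` to `q` that stay inside `S`.
For `S = univ` this is the Riemannian distance of `Nil₃(τ)`; for an embedded surface `S` it is the
intrinsic Riemannian distance of `S` for the induced metric. -/
noncomputable def distIn (τ : ℝ) (S : Set Pt) (p q : Pt) : ℝ≥0∞ :=
  ⨅ (γ : ℝ → Pt) (_ : ContDiffOn ℝ 1 γ (Icc 0 1)) (_ : γ 0 = p) (_ : γ 1 = q)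
    (_ : ∀ t ∈ Icc (0 : ℝ) 1, γ t ∈ S), curveLength τ γ

/-- The geodesic ball of `S` of radius `R` centered at `p`. -/
def ballIn (τ : ℝ) (S : Set Pt) (p : Pt) (R : ℝ) : Set Pt :=
  {q | q ∈ S ∧ distIn τ S p q < ENNReal.ofReal R}

/-- Partial derivative with respect to the first variable in the plane. -/
noncomputable def pdx {E : Type*} [NormedAddCommGroup E] [NormedSpace ℝ E]
    (h : ℝ × ℝ → E) (p : ℝ × ℝ) : E := fderiv ℝ h p (1, 0)

/-- Partial derivative with respect to the second variable in the plane. -/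
noncomputable def pdy {E : Type*} [NormedAddCommGroup E] [NormedSpace ℝ E]
    (h : ℝ × ℝ → E) (p : ℝ × ℝ) : E := fderiv ℝ h p (0, 1)

/-! First fundamental form of a surface in `Nil₃(τ)` parametrized by `X : ℝ² → Nil₃(τ)`. -/

/-- The coefficient `⟨X_x, X_x⟩`. -/
noncomputable def gramE (τ : ℝ) (X : ℝ × ℝ → Pt) (p : ℝ × ℝ) : ℝ :=
  metric τ (X p) (pdx X p) (pdx X p)

/-- The coefficient `⟨X_x, X_y⟩`. -/
noncomputable def gramF (τ : ℝ) (X : ℝ × ℝ → Pt) (p : ℝ × ℝ) : ℝ :=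
  metric τ (X p) (pdx X p) (pdy X p)

/-- The coefficient `⟨X_y, X_y⟩`. -/
noncomputable def gramG (τ : ℝ) (X : ℝ × ℝ → Pt) (p : ℝ × ℝ) : ℝ :=
  metric τ (X p) (pdy X p) (pdy X p)

/-- The area density `√(EG - F²)`. -/
noncomputable def areaDensity (τ : ℝ) (X : ℝ × ℝ → Pt) (p : ℝ × ℝ) : ℝ :=
  Real.sqrt (gramE τ X p * gramG τ X p - gramF τ X p ^ 2)

/-- The area of the part of the (injectively parametrized) surface `X` that lies in `A`. -/
noncomputable def area (τ : ℝ) (X : ℝ × ℝ → Pt) (A : Set Pt) : ℝ≥0∞ :=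
  ∫⁻ p in X ⁻¹' A, ENNReal.ofReal (areaDensity τ X p)

/-- The Laplace–Beltrami operator of the surface `X` with the induced metric, applied to a function
on the surface that is expressed in the coordinates of the parametrization. -/
noncomputable def laplacian (τ : ℝ) (X : ℝ × ℝ → Pt) (u : ℝ × ℝ → ℝ) (p : ℝ × ℝ) : ℝ :=
  (pdx (fun q => (gramG τ X q * pdx u q - gramF τ X q * pdy u q) / areaDensity τ X q) p
    + pdy (fun q => (gramE τ X q * pdy u q - gramF τ X q * pdx u q) / areaDensity τ X q) p)
    / areaDensity τ X p

/-- The area function `a` has growth of order at least `f`. -/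
def GrowthAtLeast (a : ℝ → ℝ≥0∞) (f : ℝ → ℝ) : Prop :=
  0 < liminf (fun R : ℝ => a R / ENNReal.ofReal (f R)) atTop

/-- The area function `a` has growth of order at most `f`. -/
def GrowthAtMost (a : ℝ → ℝ≥0∞) (f : ℝ → ℝ) : Prop :=
  limsup (fun R : ℝ => a R / ENNReal.ofReal (f R)) atTop < ⊤

/-- Exactly cubic growth: of order at least `R³` and of order at most `R³`. -/
def CubicGrowth (a : ℝ → ℝ≥0∞) : Prop :=
  GrowthAtLeast a (fun R => R ^ 3) ∧ GrowthAtMost a (fun R => R ^ 3)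

/-- The area of the part of the surface `X` in the geodesic ball of `Nil₃(τ)` of radius `R`
centered at `p₀`. -/
noncomputable def extrinsicArea (τ : ℝ) (X : ℝ × ℝ → Pt) (p₀ : Pt) (R : ℝ) : ℝ≥0∞ :=
  area τ X (ballIn τ univ p₀ R)

/-- The area of the geodesic ball of the surface `X` of radius `R` centered at `p₀`. -/
noncomputable def intrinsicArea (τ : ℝ) (X : ℝ × ℝ → Pt) (p₀ : Pt) (R : ℝ) : ℝ≥0∞ :=
  area τ X (ballIn τ (range X) p₀ R)

/-- The surface `X` is parabolic: its only non-positive subharmonic functions are constant. -/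
def IsParabolic (τ : ℝ) (X : ℝ × ℝ → Pt) : Prop :=
  ∀ u : ℝ × ℝ → ℝ, ContDiff ℝ 2 u → (∀ p, 0 ≤ laplacian τ X u p) → (∀ p, u p ≤ 0) →
    ∃ c : ℝ, ∀ p, u p = c

/-- The surface `S`, with the metric induced from `Nil₃(τ)`, is globally conformal to `ℂ`: it has a
smooth bijective parametrization by `ℂ` that pulls the metric back to a positive multiple of the
Euclidean one (in particular an immersion). -/
def IsConformalToPlane (τ : ℝ) (S : Set Pt) : Prop :=
  ∃ (Φ : ℂ → Pt) (ρ : ℂ → ℝ), ContDiff ℝ ∞ Φ ∧ Function.Injective Φ ∧ range Φ = S ∧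
    (∀ ζ, 0 < ρ ζ) ∧
    ∀ ζ v w : ℂ, metric τ (Φ ζ) (fderiv ℝ Φ ζ v) (fderiv ℝ Φ ζ w) = ρ ζ * inner ℝ v w

/-- The parametrization `(x, y) ↦ (x, y, u(x, y))` of the entire graph of `u`. -/
def graphMap (u : ℝ × ℝ → ℝ) (p : ℝ × ℝ) : Pt := (p.1, p.2, u p)

/-- The first component of `Gu = (u_x + τ y) ∂x + (u_y - τ x) ∂y`. -/
noncomputable def gradX (τ : ℝ) (u : ℝ × ℝ → ℝ) (p : ℝ × ℝ) : ℝ := pdx u p + τ * p.2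

/-- The second component of `Gu = (u_x + τ y) ∂x + (u_y - τ x) ∂y`. -/
noncomputable def gradY (τ : ℝ) (u : ℝ × ℝ → ℝ) (p : ℝ × ℝ) : ℝ := pdy u p - τ * p.1

/-- The mean curvature `H(u) = ½ div (Gu / √(1 + |Gu|²))` of the graph of `u` in `Nil₃(τ)`. -/
noncomputable def graphMeanCurvature (τ : ℝ) (u : ℝ × ℝ → ℝ) (p : ℝ × ℝ) : ℝ :=
  (pdx (fun q => gradX τ u q / Real.sqrt (1 + gradX τ u q ^ 2 + gradY τ u q ^ 2)) p
    + pdy (fun q => gradY τ u q / Real.sqrt (1 + gradX τ u q ^ 2 + gradY τ u q ^ 2)) p) / 2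

/-- The entire graph of `u` is a minimal surface of `Nil₃(τ)`. -/
def IsMinimalGraph (τ : ℝ) (u : ℝ × ℝ → ℝ) : Prop :=
  ContDiff ℝ 2 u ∧ ∀ p, graphMeanCurvature τ u p = 0

/-- The Figueroa–Mercuri–Pedrosa function `f_θ`. -/
noncomputable def fmp (τ θ : ℝ) (p : ℝ × ℝ) : ℝ :=
  τ * p.1 * p.2 + Real.sinh θ / (4 * τ) *
    (2 * τ * p.2 * Real.sqrt (1 + 4 * τ ^ 2 * p.2 ^ 2) + Real.arsinh (2 * τ * p.2))

/-- The surface `Σ_θ` in `Nil₃(τ)`, as the parametrized entire graph of `f_θ`. -/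
noncomputable def fmpSurface (τ θ : ℝ) : ℝ × ℝ → Pt := graphMap (fmp τ θ)

end HeisenbergGraphs

namespace HeisenbergGraphs

/-! ### First-order geometry of the surfaces `Σ_θ` -/

/-! Write w(y) = √(1 + 4τ²y²). In the coordinates (x, y) the induced metric of Σ_θ is (w dx + 2τy
sinh θ dy)² + cosh²θ dy² (`metric_fderiv_fmpSurface`), and everything follows from this formula.
Since dw = (4τ²y / w) dy, the function ξ = x + (sinh θ / 2τ) w turns it into w² dξ² + cosh²θ dy².
Then dη = (cosh θ / w) dy, that is 2τy = sinh(2τη / cosh θ), turns it into w² (dξ² + dη²) on the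
whole plane. This is the conformal equivalence with ℂ.

Parabolicity: w² times the Laplacian of Σ_θ is the flat Laplacian in (ξ, η), as seen by comparing
`laplacian_fmp` with `planeLaplacian_comp_isothermal`. It remains to prove Liouville's theorem for
subharmonic functions bounded above on the plane. Circular means are convex in the logarithm of the
radius; being bounded above they are constant, so the function is harmonic. Applied to exp V as well
as V, this kills the gradient, because Δ exp V = exp V (ΔV + |∇V|²).

Area growth: the area density is w cosh θ, of order |y|. The functions x and y are 1-Lipschitz, so a
ball of radius R lies over a square of side 2R, where the density is O(R). Conversely, along y = 0
the factor w is 1, so a path that descends to y = 0, changes ξ there and climbs back has length at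
most about |Δξ| + cosh θ (|y₀| + |y|). A ball therefore contains a region of area of order R² in the
(x, y)-plane where |y| is of order R. Both bounds hold for curves confined to a set S, so that the
extrinsic and intrinsic cases are treated together. -/

/-- The function `√(1 + 4 τ² y²)`, the conformal factor of `Σ_θ`. -/
noncomputable def weight (τ y : ℝ) : ℝ := Real.sqrt (1 + 4 * τ ^ 2 * y ^ 2)

theorem weight_sq (τ y : ℝ) : weight τ y ^ 2 = 1 + 4 * τ ^ 2 * y ^ 2 :=
  Real.sq_sqrt (by positivity)

theorem weight_pos (τ y : ℝ) : 0 < weight τ y := Real.sqrt_pos.2 (by positivity)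

theorem weight_ne_zero (τ y : ℝ) : weight τ y ≠ 0 := (weight_pos τ y).ne'

@[simp] theorem weight_zero (τ : ℝ) : weight τ 0 = 1 := by simp [weight]

theorem contDiff_weight (τ : ℝ) {n : WithTop ℕ∞} : ContDiff ℝ n (weight τ) := by
  unfold weight
  refine ContDiff.sqrt (by fun_prop) fun y => by positivity

theorem hasDerivAt_weight (τ y : ℝ) : HasDerivAt (weight τ) (4 * τ ^ 2 * y / weight τ y) y := by
  have h : HasDerivAt (fun y : ℝ => 1 + 4 * τ ^ 2 * y ^ 2) (4 * τ ^ 2 * (2 * y)) y := by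
    simpa using ((hasDerivAt_pow 2 y).const_mul (4 * τ ^ 2)).const_add 1
  refine (h.sqrt (by positivity)).congr_deriv ?_
  have := weight_ne_zero τ y
  change 4 * τ ^ 2 * (2 * y) / (2 * weight τ y) = _
  field_simp

theorem weight_le (τ y : ℝ) : weight τ y ≤ 1 + 2 * |τ| * |y| := by
  refine Real.sqrt_le_iff.2 ⟨by positivity, ?_⟩
  have : 0 ≤ |τ| * |y| := by positivity
  nlinarith [sq_abs τ, sq_abs y, mul_pow |τ| |y| 2]

theorem le_weight (τ y : ℝ) : 2 * |τ| * |y| ≤ weight τ y := by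
  refine Real.le_sqrt_of_sq_le ?_
  nlinarith [sq_abs τ, sq_abs y, mul_pow (2 * |τ|) |y| 2, mul_pow 2 |τ| 2]

theorem contDiff_fmp (τ θ : ℝ) {n : WithTop ℕ∞} : ContDiff ℝ n (fmp τ θ) := by
  have h1 : ContDiff ℝ n fun p : ℝ × ℝ => Real.sqrt (1 + 4 * τ ^ 2 * p.2 ^ 2) :=
    (contDiff_weight τ).comp contDiff_snd
  have h2 : ContDiff ℝ n fun p : ℝ × ℝ => Real.arsinh (2 * τ * p.2) :=
    Real.contDiff_arsinh.comp (by fun_prop)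
  unfold fmp
  fun_prop

theorem contDiff_fmpSurface (τ θ : ℝ) {n : WithTop ℕ∞} : ContDiff ℝ n (fmpSurface τ θ) :=
  contDiff_fst.prodMk (contDiff_snd.prodMk (contDiff_fmp τ θ))

/-- The derivative of the profile of `f_θ`. -/
theorem hasDerivAt_profile {τ : ℝ} (hτ : τ ≠ 0) (θ y : ℝ) :
    HasDerivAt (fun y => Real.sinh θ / (4 * τ) *
      (2 * τ * y * weight τ y + Real.arsinh (2 * τ * y))) (Real.sinh θ * weight τ y) y := by
  have h0 : HasDerivAt (fun y : ℝ => 2 * τ * y) (2 * τ) y := by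
    simpa using (hasDerivAt_id y).const_mul (2 * τ)
  have h1 := (h0.mul (hasDerivAt_weight τ y)).add h0.arsinh
  refine (h1.const_mul (Real.sinh θ / (4 * τ))).congr_deriv ?_
  have hw : √(1 + (2 * τ * y) ^ 2) = weight τ y := by
    unfold weight; congr 1; ring
  have := weight_ne_zero τ y
  have h2 := weight_sq τ y
  rw [hw]
  simp only [smul_eq_mul]
  field_simp
  linear_combination (-2 * Real.sinh θ) * h2

theorem hasFDerivAt_fmp {τ : ℝ} (hτ : τ ≠ 0) (θ : ℝ) (p : ℝ × ℝ) :
    HasFDerivAt (fmp τ θ) ((τ * p.2) • ContinuousLinearMap.fst ℝ ℝ ℝ +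
      (τ * p.1 + Real.sinh θ * weight τ p.2) • ContinuousLinearMap.snd ℝ ℝ ℝ) p := by
  have h1 : HasFDerivAt (fun q : ℝ × ℝ => q.1) (ContinuousLinearMap.fst ℝ ℝ ℝ) p := hasFDerivAt_fst
  have h2 : HasFDerivAt (fun q : ℝ × ℝ => q.2) (ContinuousLinearMap.snd ℝ ℝ ℝ) p := hasFDerivAt_snd
  have h3 := (hasDerivAt_profile hτ θ p.2).comp_hasFDerivAt p h2
  refine (((h1.const_mul τ).mul h2).add h3).congr_fderiv ?_
  ext
  · simp; ring
  · simp

theorem pdx_fmp {τ : ℝ} (hτ : τ ≠ 0) (θ : ℝ) (p : ℝ × ℝ) : pdx (fmp τ θ) p = τ * p.2 := by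
  simp [pdx, (hasFDerivAt_fmp hτ θ p).fderiv]

theorem pdy_fmp {τ : ℝ} (hτ : τ ≠ 0) (θ : ℝ) (p : ℝ × ℝ) :
    pdy (fmp τ θ) p = τ * p.1 + Real.sinh θ * weight τ p.2 := by
  simp [pdy, (hasFDerivAt_fmp hτ θ p).fderiv]

theorem fderiv_fmpSurface {τ : ℝ} (hτ : τ ≠ 0) (θ : ℝ) (p v : ℝ × ℝ) :
    fderiv ℝ (fmpSurface τ θ) p v =
      (v.1, v.2, τ * p.2 * v.1 + (τ * p.1 + Real.sinh θ * weight τ p.2) * v.2) := by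
  have h : HasFDerivAt (fmpSurface τ θ) _ p :=
    (hasFDerivAt_fst (p := p)).prodMk ((hasFDerivAt_snd (p := p)).prodMk (hasFDerivAt_fmp hτ θ p))
  rw [h.fderiv]
  simp

/-- The metric of `Σ_θ` in the coordinates `(x, y)`. -/
theorem metric_fderiv_fmpSurface {τ : ℝ} (hτ : τ ≠ 0) (θ : ℝ) (p v w : ℝ × ℝ) :
    metric τ (fmpSurface τ θ p) (fderiv ℝ (fmpSurface τ θ) p v) (fderiv ℝ (fmpSurface τ θ) p w) =
      (weight τ p.2 * v.1 + Real.sinh θ * (2 * τ * p.2) * v.2) *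
        (weight τ p.2 * w.1 + Real.sinh θ * (2 * τ * p.2) * w.2) +
        Real.cosh θ ^ 2 * (v.2 * w.2) := by
  rw [fderiv_fmpSurface hτ, fderiv_fmpSurface hτ]
  -- The vertical component of the image of v is 2τy v₁ + sinh θ w v₂. The regrouping into two
  -- squares uses w² - 4τ²y² = 1 and 1 + sinh²θ = cosh²θ.
  simp only [metric, vert, fmpSurface, graphMap, Real.cosh_sq]
  linear_combination (Real.sinh θ ^ 2 * v.2 * w.2 - v.1 * w.1) * weight_sq τ p.2

theorem gramE_fmp {τ : ℝ} (hτ : τ ≠ 0) (θ : ℝ) (p : ℝ × ℝ) :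
    gramE τ (fmpSurface τ θ) p = weight τ p.2 ^ 2 := by
  simp only [gramE, pdx, metric_fderiv_fmpSurface hτ]; ring

theorem gramF_fmp {τ : ℝ} (hτ : τ ≠ 0) (θ : ℝ) (p : ℝ × ℝ) :
    gramF τ (fmpSurface τ θ) p = weight τ p.2 * (Real.sinh θ * (2 * τ * p.2)) := by
  simp only [gramF, pdx, pdy, metric_fderiv_fmpSurface hτ]; ring

theorem gramG_fmp {τ : ℝ} (hτ : τ ≠ 0) (θ : ℝ) (p : ℝ × ℝ) :
    gramG τ (fmpSurface τ θ) p = (Real.sinh θ * (2 * τ * p.2)) ^ 2 + Real.cosh θ ^ 2 := by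
  simp only [gramG, pdy, metric_fderiv_fmpSurface hτ]; ring

theorem areaDensity_fmp {τ : ℝ} (hτ : τ ≠ 0) (θ : ℝ) (p : ℝ × ℝ) :
    areaDensity τ (fmpSurface τ θ) p = Real.cosh θ * weight τ p.2 := by
  rw [areaDensity, gramE_fmp hτ, gramF_fmp hτ, gramG_fmp hτ]
  refine (congrArg _ ?_).trans
    (Real.sqrt_sq (mul_pos (Real.cosh_pos θ) (weight_pos τ p.2)).le)
  ring

/-- Here Gu = (2τy, w sinh θ) and √(1 + |Gu|²) = w cosh θ. The first component of the normalized
field depends on y alone and the second is the constant tanh θ, so the divergence vanishes. -/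
theorem isMinimalGraph_fmp {τ : ℝ} (hτ : τ ≠ 0) (θ : ℝ) : IsMinimalGraph τ (fmp τ θ) := by
  refine ⟨contDiff_fmp τ θ, fun p => ?_⟩
  have hX : gradX τ (fmp τ θ) = fun q => 2 * τ * q.2 := by
    funext q; rw [gradX, pdx_fmp hτ]; ring
  have hY : gradY τ (fmp τ θ) = fun q => Real.sinh θ * weight τ q.2 := by
    funext q; rw [gradY, pdy_fmp hτ]; ring
  have hS (q : ℝ × ℝ) : Real.sqrt (1 + (2 * τ * q.2) ^ 2 + (Real.sinh θ * weight τ q.2) ^ 2) =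
      Real.cosh θ * weight τ q.2 := by
    refine (congrArg _ ?_).trans
      (Real.sqrt_sq (mul_pos (Real.cosh_pos θ) (weight_pos τ q.2)).le)
    rw [mul_pow (Real.cosh θ), Real.cosh_sq]
    linear_combination -weight_sq τ q.2
  have hc := (Real.cosh_pos θ).ne'
  have h2 (q : ℝ × ℝ) : Real.sinh θ * weight τ q.2 / (Real.cosh θ * weight τ q.2) =
      Real.sinh θ / Real.cosh θ := by
    have := weight_ne_zero τ q.2
    field_simp
  rw [graphMeanCurvature, hX, hY]
  simp only [hS, h2]
  have hd : DifferentiableAt ℝ (fun y : ℝ => 2 * τ * y / (Real.cosh θ * weight τ y)) p.2 := by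
    have := (contDiff_weight τ (n := 1)).differentiable one_ne_zero p.2
    exact (by fun_prop : DifferentiableAt ℝ (fun y : ℝ => 2 * τ * y) p.2).div (by fun_prop)
      (mul_ne_zero hc (weight_ne_zero _ _))
  have h3 := hd.hasFDerivAt.comp p (hasFDerivAt_snd (𝕜 := ℝ) (E := ℝ) (F := ℝ) (p := p))
  have h4 : pdx (fun q : ℝ × ℝ => 2 * τ * q.2 / (Real.cosh θ * weight τ q.2)) p = 0 := by
    have h5 := h3.fderiv
    simp only [Function.comp_def] at h5
    simp [pdx, h5]
  rw [h4]
  simp [pdy]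

/-! ### Isothermal coordinates -/

/-- The change of coordinates from isothermal coordinates `(ξ, η)` of `Σ_θ` to `(x, y)`. -/
noncomputable def isothermal (τ θ : ℝ) (q : ℝ × ℝ) : ℝ × ℝ :=
  (q.1 - Real.sinh θ / (2 * τ) * Real.cosh (2 * τ / Real.cosh θ * q.2),
    Real.sinh (2 * τ / Real.cosh θ * q.2) / (2 * τ))

theorem weight_isothermal {τ : ℝ} (hτ : τ ≠ 0) (θ : ℝ) (q : ℝ × ℝ) :
    weight τ (isothermal τ θ q).2 = Real.cosh (2 * τ / Real.cosh θ * q.2) := by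
  rw [weight, ← Real.sqrt_sq (Real.cosh_pos (2 * τ / Real.cosh θ * q.2)).le, Real.cosh_sq,
    isothermal]
  congr 1
  field_simp
  ring

theorem two_mul_isothermal_snd {τ : ℝ} (hτ : τ ≠ 0) (θ : ℝ) (q : ℝ × ℝ) :
    2 * τ * (isothermal τ θ q).2 = Real.sinh (2 * τ / Real.cosh θ * q.2) := by
  rw [isothermal]; field_simp

theorem contDiff_isothermal (τ θ : ℝ) {n : WithTop ℕ∞} : ContDiff ℝ n (isothermal τ θ) := by
  have h : ContDiff ℝ n fun q : ℝ × ℝ => 2 * τ / Real.cosh θ * q.2 := by fun_prop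
  have h1 := Real.contDiff_sinh.comp h
  have h2 := Real.contDiff_cosh.comp h
  exact (contDiff_fst.sub (h2.const_smul (Real.sinh θ / (2 * τ)))).prodMk (h1.div_const _)

theorem isothermal_bijective {τ : ℝ} (hτ : τ ≠ 0) (θ : ℝ) :
    Function.Bijective (isothermal τ θ) := by
  have hc := (Real.cosh_pos θ).ne'
  have hk : 2 * τ / Real.cosh θ ≠ 0 := by positivity
  constructor
  · rintro ⟨a, b⟩ ⟨a', b'⟩ h
    simp only [isothermal, Prod.mk.injEq] at h
    have h1 : b = b' := by
      have := h.2
      rw [div_left_inj' (by positivity), Real.sinh_inj] at this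
      exact mul_left_cancel₀ hk this
    subst h1
    simpa using h.1
  · rintro ⟨x, y⟩
    refine ⟨(x + Real.sinh θ / (2 * τ) * Real.cosh (Real.arsinh (2 * τ * y)),
      Real.cosh θ / (2 * τ) * Real.arsinh (2 * τ * y)), ?_⟩
    have : 2 * τ / Real.cosh θ * (Real.cosh θ / (2 * τ) * Real.arsinh (2 * τ * y)) =
      Real.arsinh (2 * τ * y) := by field_simp
    simp only [isothermal, this, Real.sinh_arsinh]
    refine Prod.ext (by simp) ?_
    simp only
    field_simp

theorem hasFDerivAt_isothermal {τ : ℝ} (hτ : τ ≠ 0) (θ : ℝ) (q : ℝ × ℝ) :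
    HasFDerivAt (isothermal τ θ)
      ((ContinuousLinearMap.fst ℝ ℝ ℝ -
        (Real.sinh θ / Real.cosh θ * (2 * τ * (isothermal τ θ q).2)) •
          ContinuousLinearMap.snd ℝ ℝ ℝ).prod
        ((weight τ (isothermal τ θ q).2 / Real.cosh θ) • ContinuousLinearMap.snd ℝ ℝ ℝ)) q := by
  have hc := (Real.cosh_pos θ).ne'
  have h0 : HasFDerivAt (fun q : ℝ × ℝ => 2 * τ / Real.cosh θ * q.2)
      ((2 * τ / Real.cosh θ) • ContinuousLinearMap.snd ℝ ℝ ℝ) q :=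
    hasFDerivAt_snd.const_mul _
  have h1 := (Real.hasDerivAt_sinh _).comp_hasFDerivAt q h0
  have h2 := (Real.hasDerivAt_cosh _).comp_hasFDerivAt q h0
  have h3 := (hasFDerivAt_fst (p := q)).sub (h2.const_mul (Real.sinh θ / (2 * τ)))
  have h4 := h1.mul_const (2 * τ)⁻¹
  refine (h3.prodMk h4).congr_fderiv ?_
  rw [two_mul_isothermal_snd hτ, weight_isothermal hτ]
  ext <;> simp <;> field_simp

/-- The differential of `isothermal` makes the two squares of the metric equal to (w dξ)² and (w
dη)², whence the factor ρ = w². -/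
theorem isConformalToPlane_fmp {τ : ℝ} (hτ : τ ≠ 0) (θ : ℝ) :
    IsConformalToPlane τ (range (fmpSurface τ θ)) := by
  have hc := (Real.cosh_pos θ).ne'
  let L : ℂ ≃L[ℝ] ℝ × ℝ := Complex.equivRealProdCLM
  have hbij := (isothermal_bijective hτ θ).comp L.bijective
  have hinj : Function.Injective (fmpSurface τ θ) := fun p q h => by
    simp only [fmpSurface, graphMap, Prod.mk.injEq] at h
    exact Prod.ext h.1 h.2.1
  refine ⟨fmpSurface τ θ ∘ isothermal τ θ ∘ L,
    fun ζ => weight τ (isothermal τ θ (L ζ)).2 ^ 2,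
    (contDiff_fmpSurface τ θ).comp ((contDiff_isothermal τ θ).comp L.contDiff),
    hinj.comp hbij.1, hbij.2.range_comp _, fun ζ => pow_pos (weight_pos _ _) 2, fun ζ v w => ?_⟩
  have h1 := (hasFDerivAt_isothermal hτ θ (L ζ)).comp ζ L.hasFDerivAt
  have h2 := ((contDiff_fmpSurface τ θ (n := 1)).differentiable one_ne_zero
    (isothermal τ θ (L ζ))).hasFDerivAt
  have h3 := h2.comp ζ h1
  rw [h3.fderiv]
  simp only [Function.comp_apply, ContinuousLinearMap.comp_apply, metric_fderiv_fmpSurface hτ]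
  simp only [L, ContinuousLinearMap.prod_apply, sub_apply,
    ContinuousLinearMap.coe_fst', ContinuousLinearMap.coe_snd', smul_apply,
    smul_eq_mul, ContinuousLinearEquiv.coe_coe, Complex.equivRealProdCLM_apply, Complex.inner,
    Complex.mul_re, Complex.conj_re, Complex.conj_im]
  field_simp
  ring

/-! ### Partial derivatives in the plane -/

theorem contDiff_pdx {g : ℝ × ℝ → ℝ} (hg : ContDiff ℝ 2 g) : ContDiff ℝ 1 (pdx g) :=
  (hg.fderiv_right (m := 1) (by norm_num)).clm_apply contDiff_const

theorem contDiff_pdy {g : ℝ × ℝ → ℝ} (hg : ContDiff ℝ 2 g) : ContDiff ℝ 1 (pdy g) :=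
  (hg.fderiv_right (m := 1) (by norm_num)).clm_apply contDiff_const

theorem continuous_pdx {g : ℝ × ℝ → ℝ} (hg : ContDiff ℝ 1 g) : Continuous (pdx g) :=
  (hg.continuous_fderiv one_ne_zero).clm_apply continuous_const

theorem continuous_pdy {g : ℝ × ℝ → ℝ} (hg : ContDiff ℝ 1 g) : Continuous (pdy g) :=
  (hg.continuous_fderiv one_ne_zero).clm_apply continuous_const

theorem fderiv_eq_pdx_pdy (g : ℝ × ℝ → ℝ) (p v : ℝ × ℝ) :
    fderiv ℝ g p v = v.1 * pdx g p + v.2 * pdy g p := by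
  have h : v = v.1 • ((1, 0) : ℝ × ℝ) + v.2 • ((0, 1) : ℝ × ℝ) := by
    ext <;> simp
  conv_lhs => rw [h]
  rw [map_add, map_smul, map_smul]
  rfl

theorem hasDerivAt_comp_pair {g : ℝ × ℝ → ℝ} {a b : ℝ → ℝ} {a' b' t : ℝ}
    (hg : ContDiff ℝ 1 g) (ha : HasDerivAt a a' t) (hb : HasDerivAt b b' t) :
    HasDerivAt (fun t => g (a t, b t)) (a' * pdx g (a t, b t) + b' * pdy g (a t, b t)) t := by
  have h := (hg.differentiable one_ne_zero (a t, b t)).hasFDerivAt.comp_hasDerivAt t (ha.prodMk hb)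
  exact h.congr_deriv (fderiv_eq_pdx_pdy _ _ _)

theorem hasDerivAt_pdx {g : ℝ × ℝ → ℝ} (hg : ContDiff ℝ 1 g) (p : ℝ × ℝ) :
    HasDerivAt (fun t => g (t, p.2)) (pdx g p) p.1 := by
  simpa using hasDerivAt_comp_pair hg (hasDerivAt_id p.1) (hasDerivAt_const p.1 p.2)

theorem hasDerivAt_pdy {g : ℝ × ℝ → ℝ} (hg : ContDiff ℝ 1 g) (p : ℝ × ℝ) :
    HasDerivAt (fun t => g (p.1, t)) (pdy g p) p.2 := by
  simpa using hasDerivAt_comp_pair hg (hasDerivAt_const p.2 p.1) (hasDerivAt_id p.2)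

theorem pdx_eq_of_hasDerivAt {g : ℝ × ℝ → ℝ} {p : ℝ × ℝ} {d : ℝ} (hg : ContDiff ℝ 1 g)
    (h : HasDerivAt (fun t => g (t, p.2)) d p.1) : pdx g p = d :=
  (hasDerivAt_pdx hg p).unique h

theorem pdy_eq_of_hasDerivAt {g : ℝ × ℝ → ℝ} {p : ℝ × ℝ} {d : ℝ} (hg : ContDiff ℝ 1 g)
    (h : HasDerivAt (fun t => g (p.1, t)) d p.2) : pdy g p = d :=
  (hasDerivAt_pdy hg p).unique h

theorem pdx_pdy_comm {g : ℝ × ℝ → ℝ} (hg : ContDiff ℝ 2 g) (p : ℝ × ℝ) :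
    pdx (pdy g) p = pdy (pdx g) p := by
  have hd : DifferentiableAt ℝ (fderiv ℝ g) p :=
    (hg.fderiv_right (m := 1) (by norm_num)).differentiable one_ne_zero p
  have hs : IsSymmSndFDerivAt ℝ g p := hg.contDiffAt.isSymmSndFDerivAt (by simp)
  have h (v w : ℝ × ℝ) : fderiv ℝ (fun q => fderiv ℝ g q v) p w = fderiv ℝ (fderiv ℝ g) p w v := by
    rw [fderiv_clm_apply hd (differentiableAt_const v)]
    simp
  exact (h (0, 1) (1, 0)).trans ((hs _ _).trans (h (1, 0) (0, 1)).symm)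

/-! ### A Liouville theorem for subharmonic functions in the plane -/

/-- The Euclidean Laplacian of the plane. -/
noncomputable def planeLaplacian (g : ℝ × ℝ → ℝ) (p : ℝ × ℝ) : ℝ :=
  pdx (pdx g) p + pdy (pdy g) p

theorem continuous_planeLaplacian {g : ℝ × ℝ → ℝ} (hg : ContDiff ℝ 2 g) :
    Continuous (planeLaplacian g) :=
  (continuous_pdx (contDiff_pdx hg)).add (continuous_pdy (contDiff_pdy hg))

theorem hasDerivAt_integral_of_continuous_deriv {F F' : ℝ → ℝ → ℝ}
    (hF : Continuous fun q : ℝ × ℝ => F q.1 q.2) (hF' : Continuous fun q : ℝ × ℝ => F' q.1 q.2)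
    (h : ∀ s t, HasDerivAt (fun s => F s t) (F' s t) s) (a b s : ℝ) :
    HasDerivAt (fun s => ∫ t in a..b, F s t) (∫ t in a..b, F' s t) s := by
  have hc (s : ℝ) : Continuous (F s) := hF.comp (continuous_const.prodMk continuous_id)
  have hc' (s : ℝ) : Continuous (F' s) := hF'.comp (continuous_const.prodMk continuous_id)
  obtain ⟨C, hC⟩ := ((isCompact_closedBall s 1).prod
    (isCompact_uIcc (a := a) (b := b))).exists_bound_of_continuousOn hF'.continuousOn
  refine (intervalIntegral.hasDerivAt_integral_of_dominated_loc_of_deriv_le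
    (bound := fun _ => C) (Metric.closedBall_mem_nhds s one_pos)
    (Eventually.of_forall fun s => (hc s).aestronglyMeasurable)
    ((hc s).intervalIntegrable _ _) (hc' s).aestronglyMeasurable
    (Eventually.of_forall fun t ht x hx => ?_) intervalIntegrable_const
    (Eventually.of_forall fun t _ x _ => h x t)).2
  exact hC (x, t) ⟨hx, uIoc_subset_uIcc ht⟩

/-- A function on the line with monotone derivative that is bounded above is constant. -/
theorem deriv_eq_zero_of_monotone_of_le {M N : ℝ → ℝ} {K : ℝ} (h : ∀ s, HasDerivAt M (N s) s)
    (hN : Monotone N) (hM : ∀ s, M s ≤ K) (s : ℝ) : N s = 0 := by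
  have hcont : Continuous M := continuous_iff_continuousAt.2 fun s => (h s).continuousAt
  have key (a b : ℝ) (hab : a < b) : N a * (b - a) ≤ M b - M a ∧ M b - M a ≤ N b * (b - a) := by
    obtain ⟨c, hc, hc'⟩ := exists_hasDerivAt_eq_slope M N hab hcont.continuousOn fun x _ => h x
    have hpos : 0 < b - a := sub_pos.2 hab
    rw [eq_div_iff hpos.ne'] at hc'
    rw [← hc']
    exact ⟨mul_le_mul_of_nonneg_right (hN hc.1.le) hpos.le,
      mul_le_mul_of_nonneg_right (hN hc.2.le) hpos.le⟩
  rcases lt_trichotomy (N s) 0 with hs | hs | hs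
  -- The distance at which the tangent line at s reaches the height K + 1. The graph of M lies above
  -- this tangent, which contradicts the bound K.
  · set d := (M s - K - 1) / N s
    have hd : 0 < d := div_pos_of_neg_of_neg (by linarith [hM s]) hs
    have h1 := (key (s - d) s (by linarith)).2
    have h2 : N s * d = M s - K - 1 := mul_div_cancel₀ _ hs.ne
    have h3 := hM (s - d)
    rw [sub_sub_cancel, h2] at h1
    linarith
  · exact hs
  · set d := (K + 1 - M s) / N s
    have hd : 0 < d := div_pos (by linarith [hM s]) hs
    have h1 := (key s (s + d) (by linarith)).1
    have h2 : N s * d = K + 1 - M s := mul_div_cancel₀ _ hs.ne'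
    have h3 := hM (s + d)
    rw [add_sub_cancel_left, h2] at h1
    linarith

/-- In logarithmic polar coordinates ∂ₛ² + ∂ₜ² = e²ˢ Δ. Hence the integral of V over t has second
derivative ∫ e²ˢ ΔV dt ≥ 0 in s. A convex function on the whole line that is bounded above is
constant, so ΔV vanishes on each circle. -/
theorem planeLaplacian_eq_zero_of_nonneg_of_le {V : ℝ × ℝ → ℝ} {K : ℝ} (hV : ContDiff ℝ 2 V)
    (hΔ : ∀ p, 0 ≤ planeLaplacian V p) (hK : ∀ p, V p ≤ K) (p : ℝ × ℝ) :
    planeLaplacian V p = 0 := by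
  have hV1 : ContDiff ℝ 1 V := hV.of_le (by norm_num)
  have hx := contDiff_pdx hV
  have hy := contDiff_pdy hV
  -- The circles are centered at p - (1, 0), so that p itself is the point s = 0, t = 0 and no limit
  -- at a center is needed. Below, A and B are the first and second s-derivatives of V along these
  -- coordinates, and T is its t-derivative.
  let a : ℝ → ℝ → ℝ := fun s t => p.1 - 1 + Real.exp s * Real.cos t
  let b : ℝ → ℝ → ℝ := fun s t => p.2 + Real.exp s * Real.sin t
  have has (s t : ℝ) : HasDerivAt (fun s => a s t) (Real.exp s * Real.cos t) s :=
    ((Real.hasDerivAt_exp s).mul_const _).const_add _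
  have hbs (s t : ℝ) : HasDerivAt (fun s => b s t) (Real.exp s * Real.sin t) s :=
    ((Real.hasDerivAt_exp s).mul_const _).const_add _
  have hat (s t : ℝ) : HasDerivAt (fun t => a s t) (Real.exp s * -Real.sin t) t :=
    ((Real.hasDerivAt_cos t).const_mul _).const_add _
  have hbt (s t : ℝ) : HasDerivAt (fun t => b s t) (Real.exp s * Real.cos t) t :=
    ((Real.hasDerivAt_sin t).const_mul _).const_add _
  have hcont : Continuous fun q : ℝ × ℝ => (a q.1 q.2, b q.1 q.2) := by
    fun_prop
  let A : ℝ → ℝ → ℝ := fun s t => Real.exp s * Real.cos t * pdx V (a s t, b s t) +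
    Real.exp s * Real.sin t * pdy V (a s t, b s t)
  let B : ℝ → ℝ → ℝ := fun s t => A s t +
    Real.exp s * Real.cos t * (Real.exp s * Real.cos t * pdx (pdx V) (a s t, b s t) +
      Real.exp s * Real.sin t * pdy (pdx V) (a s t, b s t)) +
    Real.exp s * Real.sin t * (Real.exp s * Real.cos t * pdx (pdy V) (a s t, b s t) +
      Real.exp s * Real.sin t * pdy (pdy V) (a s t, b s t))
  let T : ℝ → ℝ → ℝ := fun s t => Real.exp s * -Real.sin t * pdx V (a s t, b s t) +
    Real.exp s * Real.cos t * pdy V (a s t, b s t)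
  have hUs (s t : ℝ) : HasDerivAt (fun s => V (a s t, b s t)) (A s t) s :=
    hasDerivAt_comp_pair hV1 (has s t) (hbs s t)
  have hAs (s t : ℝ) : HasDerivAt (fun s => A s t) (B s t) s := by
    refine ((((Real.hasDerivAt_exp s).mul_const (Real.cos t)).mul
      (hasDerivAt_comp_pair hx (has s t) (hbs s t))).add
      (((Real.hasDerivAt_exp s).mul_const (Real.sin t)).mul
      (hasDerivAt_comp_pair hy (has s t) (hbs s t)))).congr_deriv ?_
    simp only [A, B]
    ring
  have hTt (s t : ℝ) : HasDerivAt (fun t => T s t)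
      (Real.exp s ^ 2 * planeLaplacian V (a s t, b s t) - B s t) t := by
    refine ((((Real.hasDerivAt_sin t).neg.const_mul (Real.exp s)).mul
      (hasDerivAt_comp_pair hx (hat s t) (hbt s t))).add
      (((Real.hasDerivAt_cos t).const_mul (Real.exp s)).mul
      (hasDerivAt_comp_pair hy (hat s t) (hbt s t)))).congr_deriv ?_
    simp only [A, B, planeLaplacian, pdx_pdy_comm hV, Pi.neg_apply]
    linear_combination Real.exp s ^ 2 * (pdx (pdx V) (a s t, b s t) +
      pdy (pdy V) (a s t, b s t)) * Real.sin_sq_add_cos_sq t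
  have cx := (continuous_pdx hV1).comp hcont
  have cy := (continuous_pdy hV1).comp hcont
  have cxx := (continuous_pdx hx).comp hcont
  have cyx := (continuous_pdy hx).comp hcont
  have cxy := (continuous_pdx hy).comp hcont
  have cyy := (continuous_pdy hy).comp hcont
  have cL := (continuous_planeLaplacian hV).comp hcont
  simp only [Function.comp_def] at cx cy cxx cyx cxy cyy cL
  have hA : Continuous fun q : ℝ × ℝ => A q.1 q.2 := by
    simp only [A]
    fun_prop
  have hB : Continuous fun q : ℝ × ℝ => B q.1 q.2 := by
    simp only [B]
    fun_prop
  have hL : Continuous fun q : ℝ × ℝ =>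
      Real.exp q.1 ^ 2 * planeLaplacian V (a q.1 q.2, b q.1 q.2) := by
    fun_prop
  have hLs (s : ℝ) : Continuous fun t =>
      Real.exp s ^ 2 * planeLaplacian V (a s t, b s t) :=
    hL.comp (continuous_const.prodMk continuous_id)
  have hBs (s : ℝ) : Continuous (B s) := hB.comp (continuous_const.prodMk continuous_id)
  have hint (s : ℝ) : ∫ t in (0 : ℝ)..2 * Real.pi, B s t = ∫ t in (0 : ℝ)..2 * Real.pi,
      Real.exp s ^ 2 * planeLaplacian V (a s t, b s t) := by
    -- The term ∂ₜ²V integrates to zero over a period, since T is 2π-periodic.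
    have h1 := intervalIntegral.integral_eq_sub_of_hasDerivAt (a := 0) (b := 2 * Real.pi)
      (fun t _ => hTt s t) (((hLs s).sub (hBs s)).intervalIntegrable _ _)
    rw [intervalIntegral.integral_sub ((hLs s).intervalIntegrable _ _)
      ((hBs s).intervalIntegrable _ _)] at h1
    have h2 : T s (2 * Real.pi) = T s 0 := by simp [T, a, b]
    linarith
  have hM := hasDerivAt_integral_of_continuous_deriv (hV.continuous.comp hcont) hA hUs
    0 (2 * Real.pi)
  have hN := hasDerivAt_integral_of_continuous_deriv hA hB hAs 0 (2 * Real.pi)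
  have hpi : (0 : ℝ) ≤ 2 * Real.pi := by positivity
  have hmono : Monotone fun s => ∫ t in (0 : ℝ)..2 * Real.pi, A s t := by
    refine monotone_of_deriv_nonneg (fun s => (hN s).differentiableAt) fun s => ?_
    rw [(hN s).deriv, hint]
    exact intervalIntegral.integral_nonneg hpi fun t _ => mul_nonneg (sq_nonneg _) (hΔ _)
  have hbd (s : ℝ) : ∫ t in (0 : ℝ)..2 * Real.pi, V (a s t, b s t) ≤ (2 * Real.pi - 0) * K := by
    rw [show (2 * Real.pi - 0) * K = ∫ _ in (0 : ℝ)..2 * Real.pi, K by simp]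
    refine intervalIntegral.integral_mono_on hpi
      (((hV.continuous.comp hcont).comp (continuous_const.prodMk continuous_id)
        ).intervalIntegrable _ _) intervalIntegrable_const fun t _ => hK _
  have hzero := deriv_eq_zero_of_monotone_of_le hM hmono hbd
  have h0 : ∫ t in (0 : ℝ)..2 * Real.pi, B 0 t = 0 := by
    have h1 := hN 0
    rw [funext hzero] at h1
    exact h1.unique (hasDerivAt_const 0 0)
  rw [hint] at h0
  by_contra hne
  refine (intervalIntegral.integral_pos (by positivity) (hLs 0).continuousOn
    (fun t _ => mul_nonneg (sq_nonneg _) (hΔ _)) ⟨0, ⟨le_rfl, hpi⟩, ?_⟩).ne' h0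
  simpa [a, b] using (hΔ p).lt_of_ne' hne

/-- W = exp V is again subharmonic and bounded above, hence harmonic. In ΔW = W (ΔV + |∇V|²) both
summands are nonnegative, so ∇V = 0. -/
theorem eq_const_of_planeLaplacian_nonneg {V : ℝ × ℝ → ℝ} {K : ℝ} (hV : ContDiff ℝ 2 V)
    (hΔ : ∀ p, 0 ≤ planeLaplacian V p) (hK : ∀ p, V p ≤ K) (p q : ℝ × ℝ) : V p = V q := by
  have hV1 : ContDiff ℝ 1 V := hV.of_le (by norm_num)
  have hx := contDiff_pdx hV
  have hy := contDiff_pdy hV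
  let W : ℝ × ℝ → ℝ := fun p => Real.exp (V p)
  have hW : ContDiff ℝ 2 W := hV.exp
  have hW1 : ContDiff ℝ 1 W := hV1.exp
  have hWx : pdx W = fun p => W p * pdx V p := funext fun p =>
    pdx_eq_of_hasDerivAt hW1 (hasDerivAt_pdx hV1 p).exp
  have hWy : pdy W = fun p => W p * pdy V p := funext fun p =>
    pdy_eq_of_hasDerivAt hW1 (hasDerivAt_pdy hV1 p).exp
  have hL (p : ℝ × ℝ) : planeLaplacian W p =
      W p * (planeLaplacian V p + (pdx V p ^ 2 + pdy V p ^ 2)) := by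
    have h1 : pdx (pdx W) p = pdx W p * pdx V p + W p * pdx (pdx V) p := by
      conv_lhs => rw [hWx]
      refine pdx_eq_of_hasDerivAt (hW1.mul hx) ?_
      exact (hasDerivAt_pdx hW1 p).mul (hasDerivAt_pdx hx p)
    have h2 : pdy (pdy W) p = pdy W p * pdy V p + W p * pdy (pdy V) p := by
      conv_lhs => rw [hWy]
      refine pdy_eq_of_hasDerivAt (hW1.mul hy) ?_
      exact (hasDerivAt_pdy hW1 p).mul (hasDerivAt_pdy hy p)
    rw [planeLaplacian, h1, h2, hWx, hWy, planeLaplacian]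
    ring
  have hpos (p : ℝ × ℝ) : 0 < W p := Real.exp_pos _
  have h0 := planeLaplacian_eq_zero_of_nonneg_of_le hW
    (fun p => by rw [hL]; have := hΔ p; have := hpos p; positivity)
    (fun p => Real.exp_le_exp.2 (hK p))
  refine is_const_of_fderiv_eq_zero (𝕜 := ℝ) (hV1.differentiable one_ne_zero) (fun p => ?_) p q
  have h1 := h0 p
  rw [hL, mul_eq_zero_iff_left (hpos p).ne'] at h1
  have h2 : pdx V p = 0 := by nlinarith [hΔ p, sq_nonneg (pdx V p), sq_nonneg (pdy V p)]
  have h3 : pdy V p = 0 := by nlinarith [hΔ p, sq_nonneg (pdx V p), sq_nonneg (pdy V p)]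
  ext <;> simp [fderiv_eq_pdx_pdy, h2, h3]

/-! ### Parabolicity -/

theorem pdx_comp_isothermal (τ θ : ℝ) {g : ℝ × ℝ → ℝ} (hg : ContDiff ℝ 1 g) (q : ℝ × ℝ) :
    pdx (g ∘ isothermal τ θ) q = pdx g (isothermal τ θ q) := by
  refine pdx_eq_of_hasDerivAt (hg.comp (contDiff_isothermal τ θ)) ?_
  have h := hasDerivAt_comp_pair hg ((hasDerivAt_id q.1).sub_const
    (Real.sinh θ / (2 * τ) * Real.cosh (2 * τ / Real.cosh θ * q.2)))
    (hasDerivAt_const q.1 (Real.sinh (2 * τ / Real.cosh θ * q.2) / (2 * τ)))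
  simpa [isothermal] using h

theorem pdy_comp_isothermal {τ : ℝ} (hτ : τ ≠ 0) (θ : ℝ) {g : ℝ × ℝ → ℝ} (hg : ContDiff ℝ 1 g)
    (q : ℝ × ℝ) : pdy (g ∘ isothermal τ θ) q =
      -(Real.sinh θ / Real.cosh θ * Real.sinh (2 * τ / Real.cosh θ * q.2)) *
        pdx g (isothermal τ θ q) +
      Real.cosh (2 * τ / Real.cosh θ * q.2) / Real.cosh θ * pdy g (isothermal τ θ q) := by
  have hc := (Real.cosh_pos θ).ne'
  refine pdy_eq_of_hasDerivAt (hg.comp (contDiff_isothermal τ θ)) ?_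
  have hlin : HasDerivAt (fun t => 2 * τ / Real.cosh θ * t) (2 * τ / Real.cosh θ) q.2 := by
    simpa using (hasDerivAt_id q.2).const_mul (2 * τ / Real.cosh θ)
  have h := hasDerivAt_comp_pair hg ((hlin.cosh.const_mul (Real.sinh θ / (2 * τ))).const_sub q.1)
    (hlin.sinh.div_const (2 * τ))
  refine h.congr_deriv ?_
  simp only [isothermal]
  congr 2 <;> field_simp

/-- The numerator is written exactly as in `laplacian_fmp`; the two right-hand sides differ only by
the conformal factor w². -/
theorem planeLaplacian_comp_isothermal {τ : ℝ} (hτ : τ ≠ 0) (θ : ℝ) {u : ℝ × ℝ → ℝ}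
    (hu : ContDiff ℝ 2 u) {p q : ℝ × ℝ} (hp : isothermal τ θ q = p) :
    planeLaplacian (u ∘ isothermal τ θ) q =
      ((Real.cosh θ ^ 2 + (Real.sinh θ * (2 * τ * p.2)) ^ 2) * pdx (pdx u) p -
        2 * Real.sinh θ * (2 * τ * p.2) * weight τ p.2 * pdy (pdx u) p +
        weight τ p.2 ^ 2 * pdy (pdy u) p - 2 * τ * Real.sinh θ * weight τ p.2 * pdx u p +
        2 * τ * (2 * τ * p.2) * pdy u p) / Real.cosh θ ^ 2 := by
  have hc := (Real.cosh_pos θ).ne'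
  have hu1 : ContDiff ℝ 1 u := hu.of_le (by norm_num)
  have hx := contDiff_pdx hu
  have hy := contDiff_pdy hu
  have hUx : pdx (u ∘ isothermal τ θ) = pdx u ∘ isothermal τ θ :=
    funext fun q => pdx_comp_isothermal τ θ hu1 q
  have hUy := funext fun q => pdy_comp_isothermal hτ θ hu1 q
  have hlin : HasDerivAt (fun t => 2 * τ / Real.cosh θ * t) (2 * τ / Real.cosh θ) q.2 := by
    simpa using (hasDerivAt_id q.2).const_mul (2 * τ / Real.cosh θ)
  have dy {g : ℝ × ℝ → ℝ} (hg : ContDiff ℝ 1 g) :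
      HasDerivAt (fun t => g (isothermal τ θ (q.1, t))) _ q.2 :=
    (hasDerivAt_pdy (hg.comp (contDiff_isothermal τ θ)) q).congr_deriv
      (pdy_comp_isothermal hτ θ hg q)
  have hUyy : pdy (pdy (u ∘ isothermal τ θ)) q = _ :=
    pdy_eq_of_hasDerivAt (contDiff_pdy (hu.comp (contDiff_isothermal τ θ))) (by
      rw [hUy]
      exact (((hlin.sinh.const_mul (Real.sinh θ / Real.cosh θ)).neg).mul (dy hx)).add
        ((hlin.cosh.div_const (Real.cosh θ)).mul (dy hy)))
  simp only [Pi.neg_apply] at hUyy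
  rw [planeLaplacian, hUx, pdx_comp_isothermal τ θ hx, hUyy, ← weight_isothermal hτ,
    ← two_mul_isothermal_snd hτ, hp, pdx_pdy_comm hu]
  field_simp
  ring

/-- Both components of the flux in the Laplace–Beltrami operator of Σ_θ have this shape, as the
metric coefficients depend on y alone. -/
theorem contDiff_mul_sub_mul {α β : ℝ → ℝ} {g h : ℝ × ℝ → ℝ} (hα : ContDiff ℝ 1 α)
    (hβ : ContDiff ℝ 1 β) (hg : ContDiff ℝ 1 g) (hh : ContDiff ℝ 1 h) :
    ContDiff ℝ 1 fun q : ℝ × ℝ => α q.2 * g q - β q.2 * h q :=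
  ((hα.comp contDiff_snd).mul hg).sub ((hβ.comp contDiff_snd).mul hh)

theorem pdx_mul_sub_mul {α β : ℝ → ℝ} {g h : ℝ × ℝ → ℝ} (hα : ContDiff ℝ 1 α)
    (hβ : ContDiff ℝ 1 β) (hg : ContDiff ℝ 1 g) (hh : ContDiff ℝ 1 h) (p : ℝ × ℝ) :
    pdx (fun q : ℝ × ℝ => α q.2 * g q - β q.2 * h q) p =
      α p.2 * pdx g p - β p.2 * pdx h p :=
  pdx_eq_of_hasDerivAt (contDiff_mul_sub_mul hα hβ hg hh)
    (((hasDerivAt_pdx hg p).const_mul (α p.2)).sub ((hasDerivAt_pdx hh p).const_mul (β p.2)))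

theorem pdy_mul_sub_mul {α β : ℝ → ℝ} {g h : ℝ × ℝ → ℝ} {a b : ℝ} {p : ℝ × ℝ}
    (hα : ContDiff ℝ 1 α) (hβ : ContDiff ℝ 1 β) (hg : ContDiff ℝ 1 g) (hh : ContDiff ℝ 1 h)
    (ha : HasDerivAt α a p.2) (hb : HasDerivAt β b p.2) :
    pdy (fun q : ℝ × ℝ => α q.2 * g q - β q.2 * h q) p =
      (a * g p + α p.2 * pdy g p) - (b * h p + β p.2 * pdy h p) :=
  pdy_eq_of_hasDerivAt (contDiff_mul_sub_mul hα hβ hg hh)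
    ((ha.mul (hasDerivAt_pdy hg p)).sub (hb.mul (hasDerivAt_pdy hh p)))

theorem laplacian_fmp {τ : ℝ} (hτ : τ ≠ 0) (θ : ℝ) {u : ℝ × ℝ → ℝ} (hu : ContDiff ℝ 2 u)
    (p : ℝ × ℝ) : laplacian τ (fmpSurface τ θ) u p =
      ((Real.cosh θ ^ 2 + (Real.sinh θ * (2 * τ * p.2)) ^ 2) * pdx (pdx u) p -
        2 * Real.sinh θ * (2 * τ * p.2) * weight τ p.2 * pdy (pdx u) p +
        weight τ p.2 ^ 2 * pdy (pdy u) p - 2 * τ * Real.sinh θ * weight τ p.2 * pdx u p +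
        2 * τ * (2 * τ * p.2) * pdy u p) / (Real.cosh θ ^ 2 * weight τ p.2 ^ 2) := by
  have hc := (Real.cosh_pos θ).ne'
  have hx := contDiff_pdx hu
  have hy := contDiff_pdy hu
  have hW (y : ℝ) := weight_ne_zero τ y
  have e1 : (fun q => (gramG τ (fmpSurface τ θ) q * pdx u q - gramF τ (fmpSurface τ θ) q * pdy u q) /
      areaDensity τ (fmpSurface τ θ) q) = fun q => ((Real.sinh θ * (2 * τ * q.2)) ^ 2 +
        Real.cosh θ ^ 2) / (Real.cosh θ * weight τ q.2) * pdx u q -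
        Real.sinh θ * (2 * τ * q.2) / Real.cosh θ * pdy u q := by
    funext q
    have := hW q.2
    rw [gramG_fmp hτ, gramF_fmp hτ, areaDensity_fmp hτ]
    field_simp
  have e2 : (fun q => (gramE τ (fmpSurface τ θ) q * pdy u q - gramF τ (fmpSurface τ θ) q * pdx u q) /
      areaDensity τ (fmpSurface τ θ) q) = fun q => weight τ q.2 / Real.cosh θ * pdy u q -
        Real.sinh θ * (2 * τ * q.2) / Real.cosh θ * pdx u q := by
    funext q
    have := hW q.2
    rw [gramE_fmp hτ, gramF_fmp hτ, areaDensity_fmp hτ]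
    field_simp
  have hlin : HasDerivAt (fun y => Real.sinh θ * (2 * τ * y) / Real.cosh θ)
      (Real.sinh θ * (2 * τ) / Real.cosh θ) p.2 := by
    simpa using (((hasDerivAt_id p.2).const_mul (2 * τ)).const_mul (Real.sinh θ)).div_const
      (Real.cosh θ)
  have cw := contDiff_weight τ (n := 1)
  have cG : ContDiff ℝ 1 fun y => ((Real.sinh θ * (2 * τ * y)) ^ 2 + Real.cosh θ ^ 2) /
      (Real.cosh θ * weight τ y) :=
    ContDiff.div (by fun_prop) (by fun_prop) fun y => mul_ne_zero hc (hW y)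
  have cF : ContDiff ℝ 1 fun y => Real.sinh θ * (2 * τ * y) / Real.cosh θ := by fun_prop
  have cE : ContDiff ℝ 1 fun y => weight τ y / Real.cosh θ := by fun_prop
  have d1 := pdx_mul_sub_mul cG cF hx hy p
  have d2 := pdy_mul_sub_mul cE cF hy hx ((hasDerivAt_weight τ p.2).div_const (Real.cosh θ)) hlin
  rw [laplacian, e1, e2, d1, d2, areaDensity_fmp hτ, pdx_pdy_comm hu]
  have hWp := hW p.2
  field_simp
  ring

theorem isParabolic_fmp {τ : ℝ} (hτ : τ ≠ 0) (θ : ℝ) : IsParabolic τ (fmpSurface τ θ) := by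
  intro u hu hΔ hu0
  refine ⟨u (isothermal τ θ 0), fun p => ?_⟩
  obtain ⟨q, rfl⟩ := (isothermal_bijective hτ θ).2 p
  refine eq_const_of_planeLaplacian_nonneg (V := u ∘ isothermal τ θ) (K := 0)
    (hu.comp (contDiff_isothermal τ θ)) (fun q => ?_) (fun q => hu0 _) q 0
  have h := hΔ (isothermal τ θ q)
  rw [laplacian_fmp hτ θ hu, ← div_div] at h
  rw [planeLaplacian_comp_isothermal hτ θ hu rfl]
  have h1 := mul_nonneg h (sq_nonneg (weight τ (isothermal τ θ q).2))
  rwa [div_mul_cancel₀ _ (pow_ne_zero 2 (weight_ne_zero _ _))] at h1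

/-! ### Distance estimates -/

/-- A primitive g of an upper bound for the speed replaces the computation of the length integral.
-/
theorem distIn_le_of_speed_le {τ : ℝ} {S : Set Pt} {γ : ℝ → Pt} {g : ℝ → ℝ} (hγ : ContDiff ℝ 1 γ)
    (hg : ContDiff ℝ 1 g) (hS : ∀ t ∈ Icc (0 : ℝ) 1, γ t ∈ S)
    (h : ∀ t, Real.sqrt (metric τ (γ t) (deriv γ t) (deriv γ t)) ≤ deriv g t) :
    distIn τ S (γ 0) (γ 1) ≤ ENNReal.ofReal (g 1 - g 0) := by
  refine iInf_le_of_le γ (iInf_le_of_le hγ.contDiffOn (iInf_le_of_le rfl (iInf_le_of_le rfl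
    (iInf_le_of_le hS ?_))))
  have hg' : Continuous (deriv g) := hg.continuous_deriv le_rfl
  have hint : ∫ t in Icc (0 : ℝ) 1, deriv g t = g 1 - g 0 := by
    rw [integral_Icc_eq_integral_Ioc, ← intervalIntegral.integral_of_le zero_le_one]
    exact intervalIntegral.integral_deriv_of_contDiffOn_Icc hg.contDiffOn zero_le_one
  rw [← hint, ofReal_integral_eq_lintegral_ofReal (hg'.integrableOn_Icc)
    (Eventually.of_forall fun t => (Real.sqrt_nonneg _).trans (h t))]
  refine setLIntegral_mono' measurableSet_Icc fun t ht => ENNReal.ofReal_le_ofReal ?_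
  rw [(hγ.differentiable one_ne_zero t).derivWithin (uniqueDiffOn_Icc zero_lt_one t ht)]
  exact h t

/-- A linear form of norm at most 1 at every point is 1-Lipschitz along curves, whatever set S
confines them. It is used for the coordinates x and y, the coefficients of E₁ and E₂. -/
theorem abs_sub_lt_of_mem_ballIn {τ : ℝ} {S : Set Pt} {p q : Pt} {R : ℝ} (L : Pt →L[ℝ] ℝ)
    (hL : ∀ p v, |L v| ≤ Real.sqrt (metric τ p v v)) (h : q ∈ ballIn τ S p R) :
    |L q - L p| < R := by
  have h' := h.2
  simp only [distIn, iInf_lt_iff] at h'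
  obtain ⟨γ, hγ, rfl, rfl, -, hlt⟩ := h'
  have h1 := enorm_sub_le_lintegral_derivWithin_Icc_of_contDiffOn_Icc
    (L.contDiff.comp_contDiffOn hγ) zero_le_one
  have h2 : ∫⁻ t in Icc (0 : ℝ) 1, ‖derivWithin (L ∘ γ) (Icc 0 1) t‖ₑ ≤ curveLength τ γ := by
    refine setLIntegral_mono' measurableSet_Icc fun t ht => ?_
    have hd := ((hγ.differentiableOn one_ne_zero) t ht).hasDerivWithinAt
    rw [((L.hasFDerivAt (x := γ t)).comp_hasDerivWithinAt t hd).derivWithin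
      (uniqueDiffOn_Icc zero_lt_one t ht), Real.enorm_eq_ofReal_abs]
    exact ENNReal.ofReal_le_ofReal (hL _ _)
  have h3 := (h1.trans h2).trans_lt hlt
  rw [Real.enorm_eq_ofReal_abs] at h3
  exact ENNReal.ofReal_lt_ofReal_iff'.1 h3 |>.1

theorem mem_box_of_mem_ballIn {τ : ℝ} {S : Set Pt} {p q : Pt} {R : ℝ} (h : q ∈ ballIn τ S p R) :
    |q.1 - p.1| < R ∧ |q.2.1 - p.2.1| < R := by
  constructor
  · refine abs_sub_lt_of_mem_ballIn (ContinuousLinearMap.fst ℝ ℝ (ℝ × ℝ)) (fun p v => ?_) h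
    refine Real.abs_le_sqrt ?_
    simp only [metric, ContinuousLinearMap.coe_fst']
    nlinarith [sq_nonneg v.2.1, sq_nonneg (vert τ p v)]
  · refine abs_sub_lt_of_mem_ballIn ((ContinuousLinearMap.fst ℝ ℝ ℝ).comp
      (ContinuousLinearMap.snd ℝ ℝ (ℝ × ℝ))) (fun p v => ?_) h
    refine Real.abs_le_sqrt ?_
    simp only [metric, ContinuousLinearMap.comp_apply, ContinuousLinearMap.coe_fst',
      ContinuousLinearMap.coe_snd']
    nlinarith [sq_nonneg v.1, sq_nonneg (vert τ p v)]

theorem metric_self_nonneg (τ : ℝ) (p v : Pt) : 0 ≤ metric τ p v v :=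
  add_nonneg (add_nonneg (mul_self_nonneg _) (mul_self_nonneg _)) (mul_self_nonneg _)

/-- Vertical translations are isometries and ∂z is a unit vector, so this is the triangle
inequality. -/
theorem sqrt_metric_add_vertical_le (τ : ℝ) (p v : Pt) (k m : ℝ) :
    Real.sqrt (metric τ (p + (0, 0, k)) (v + (0, 0, m)) (v + (0, 0, m))) ≤
      Real.sqrt (metric τ p v v) + |m| := by
  refine Real.sqrt_le_iff.2 ⟨by positivity, ?_⟩
  have h1 := Real.sq_sqrt (metric_self_nonneg τ p v)
  have h2 : |vert τ p v| ≤ Real.sqrt (metric τ p v v) := by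
    refine Real.abs_le_sqrt ?_
    simp only [metric]
    nlinarith [sq_nonneg v.1, sq_nonneg v.2.1]
  have h3 : vert τ p v * m ≤ Real.sqrt (metric τ p v v) * |m| :=
    (le_abs_self _).trans ((abs_mul _ _).trans_le (mul_le_mul_of_nonneg_right h2 (abs_nonneg m)))
  have h4 : metric τ (p + (0, 0, k)) (v + (0, 0, m)) (v + (0, 0, m)) =
      metric τ p v v + 2 * (vert τ p v * m) + m ^ 2 := by
    simp only [metric, vert, Prod.fst_add, Prod.snd_add]
    ring
  rw [add_sq, h1, sq_abs, h4]
  linarith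

theorem deriv_smoothTransition_nonneg (x : ℝ) : 0 ≤ deriv Real.smoothTransition x :=
  Real.smoothTransition.monotone.deriv_nonneg

/-- The endpoint 0 is included, as 1 is in the next lemma, so that consecutive stages of a path
built from `Real.smoothTransition` meet without overlap. -/
theorem deriv_smoothTransition_of_nonpos {x : ℝ} (hx : x ≤ 0) :
    deriv Real.smoothTransition x = 0 := by
  refine IsLocalMin.deriv_eq_zero (Eventually.of_forall fun y => ?_)
  rw [Real.smoothTransition.zero_of_nonpos hx]
  exact Real.smoothTransition.nonneg y

theorem deriv_smoothTransition_of_one_le {x : ℝ} (hx : 1 ≤ x) :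
    deriv Real.smoothTransition x = 0 := by
  refine IsLocalMax.deriv_eq_zero (Eventually.of_forall fun y => ?_)
  rw [Real.smoothTransition.one_of_one_le hx]
  exact Real.smoothTransition.le_one y

/-- The first isothermal coordinate `ξ` of the point of `Σ_θ` over `(x, y)`. -/
noncomputable def isoFst (τ θ : ℝ) (q : ℝ × ℝ) : ℝ :=
  q.1 + Real.sinh θ / (2 * τ) * weight τ q.2

/-- To go from `p₀` to the point of `Σ_θ` over `q`, move in the coordinates `(ξ, y)` first to
`y = 0`, then along `y = 0`, where the conformal factor is `1`, and then to the final `y`, while the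
height over `Σ_θ` decreases to `0`. -/
theorem distIn_fmpSurface_le {τ : ℝ} (hτ : τ ≠ 0) (θ : ℝ) {S : Set Pt} (p₀ : Pt) (q : ℝ × ℝ)
    (hS : ∀ (p : ℝ × ℝ) (k : ℝ),
      fmpSurface τ θ p + (0, 0, k * (p₀.2.2 - fmp τ θ (p₀.1, p₀.2.1))) ∈ S) :
    distIn τ S p₀ (fmpSurface τ θ q) ≤ ENNReal.ofReal
      (|isoFst τ θ q - isoFst τ θ (p₀.1, p₀.2.1)| + Real.cosh θ * |p₀.2.1| +
        Real.cosh θ * |q.2| + |p₀.2.2 - fmp τ θ (p₀.1, p₀.2.1)|) := by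
  set k := p₀.2.2 - fmp τ θ (p₀.1, p₀.2.1) with hk
  set d := isoFst τ θ q - isoFst τ θ (p₀.1, p₀.2.1) with hd
  have hT : ContDiff ℝ 1 Real.smoothTransition := Real.smoothTransition.contDiff (n := 1)
  let σ : ℝ → ℝ := Real.smoothTransition
  let σ' : ℝ → ℝ := deriv Real.smoothTransition
  have hσ (c t : ℝ) : HasDerivAt (fun t => σ (3 * t - c)) (3 * σ' (3 * t - c)) t := by
    have h1 : HasDerivAt (fun t : ℝ => 3 * t - c) 3 t := by
      simpa using ((hasDerivAt_id t).const_mul 3).sub_const c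
    have h2 := (hT.differentiable one_ne_zero (3 * t - c)).hasDerivAt.comp t h1
    exact h2.congr_deriv (mul_comm _ _)
  have hσc (c : ℝ) : ContDiff ℝ 1 (fun t => σ (3 * t - c)) := hT.comp (by fun_prop)
  have hσ0 (t : ℝ) : HasDerivAt σ (σ' t) t := (hT.differentiable one_ne_zero t).hasDerivAt
  have c0 := hσc 0
  have c1 := hσc 1
  have c2 := hσc 2
  have c3 : ContDiff ℝ 1 σ := hT
  -- The shifts 0, 1, 2 in σ(3t - c) place the three moves in the successive thirds of [0, 1]: y
  -- from its initial value to 0, then ξ, then y from 0 to its final value. The function x is chosen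
  -- so that ξ changes only in the middle third.
  let y : ℝ → ℝ := fun t => p₀.2.1 * (1 - σ (3 * t - 0)) + q.2 * σ (3 * t - 2)
  let y' : ℝ → ℝ := fun t => p₀.2.1 * -(3 * σ' (3 * t - 0)) + q.2 * (3 * σ' (3 * t - 2))
  have hy (t : ℝ) : HasDerivAt y (y' t) t :=
    (((hσ 0 t).const_sub 1).const_mul _).add ((hσ 2 t).const_mul _)
  have cy : ContDiff ℝ 1 y := by fun_prop
  let x : ℝ → ℝ := fun t => isoFst τ θ (p₀.1, p₀.2.1) + d * σ (3 * t - 1) -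
    Real.sinh θ / (2 * τ) * weight τ (y t)
  have hx (t : ℝ) : HasDerivAt x (d * (3 * σ' (3 * t - 1)) -
      Real.sinh θ / (2 * τ) * (4 * τ ^ 2 * y t / weight τ (y t) * y' t)) t :=
    (((hσ 1 t).const_mul d).const_add _).sub
      (((hasDerivAt_weight τ (y t)).comp t (hy t)).const_mul _)
  have cx : ContDiff ℝ 1 x :=
    (contDiff_const.add (contDiff_const.mul c1)).sub
      (contDiff_const.mul ((contDiff_weight τ).comp cy))
  let γ : ℝ → Pt := fun t => fmpSurface τ θ (x t, y t) + (0, 0, (1 - σ t) * k)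
  have cγ : ContDiff ℝ 1 γ :=
    ((contDiff_fmpSurface τ θ).comp (cx.prodMk cy)).add
      (contDiff_const.prodMk (contDiff_const.prodMk ((contDiff_const.sub c3).mul contDiff_const)))
  have hγ (t : ℝ) : HasDerivAt γ (fderiv ℝ (fmpSurface τ θ) (x t, y t)
      (d * (3 * σ' (3 * t - 1)) -
        Real.sinh θ / (2 * τ) * (4 * τ ^ 2 * y t / weight τ (y t) * y' t), y' t) +
      (0, 0, -σ' t * k)) t :=
    (((contDiff_fmpSurface τ θ (n := 1)).differentiable one_ne_zero _).hasFDerivAt.comp_hasDerivAt t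
      ((hx t).prodMk (hy t))).add ((hasDerivAt_const t 0).prodMk ((hasDerivAt_const t 0).prodMk
        (((hσ0 t).const_sub 1).mul_const k)))
  let g : ℝ → ℝ := fun t => |d| * σ (3 * t - 1) + Real.cosh θ * |p₀.2.1| * σ (3 * t - 0) +
    Real.cosh θ * |q.2| * σ (3 * t - 2) + |k| * σ t
  have hg (t : ℝ) : HasDerivAt g (|d| * (3 * σ' (3 * t - 1)) +
      Real.cosh θ * |p₀.2.1| * (3 * σ' (3 * t - 0)) +
      Real.cosh θ * |q.2| * (3 * σ' (3 * t - 2)) + |k| * σ' t) t :=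
    ((((hσ 1 t).const_mul _).add ((hσ 0 t).const_mul _)).add ((hσ 2 t).const_mul _)).add
      ((hσ0 t).const_mul _)
  have cg : ContDiff ℝ 1 g := by fun_prop
  have hσn (t : ℝ) : 0 ≤ σ' t := deriv_smoothTransition_nonneg t
  have e0 : γ 0 = p₀ := by
    have s0 : σ 0 = 0 := Real.smoothTransition.zero
    have s1 : σ (3 * 0 - 0) = 0 := Real.smoothTransition.zero_of_nonpos (by norm_num)
    have s2 : σ (3 * 0 - 1) = 0 := Real.smoothTransition.zero_of_nonpos (by norm_num)
    have s3 : σ (3 * 0 - 2) = 0 := Real.smoothTransition.zero_of_nonpos (by norm_num)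
    have hy0 : y 0 = p₀.2.1 := by simp only [y, s1, s3]; ring
    have hx0 : x 0 = p₀.1 := by simp only [x, s2, hy0, isoFst]; ring
    simp only [γ, hx0, hy0, s0, hk, fmpSurface, graphMap]
    ext <;> simp
  have e1 : γ 1 = fmpSurface τ θ q := by
    have s0 : σ 1 = 1 := Real.smoothTransition.one
    have s1 : σ (3 * 1 - 0) = 1 := Real.smoothTransition.one_of_one_le (by norm_num)
    have s2 : σ (3 * 1 - 1) = 1 := Real.smoothTransition.one_of_one_le (by norm_num)
    have s3 : σ (3 * 1 - 2) = 1 := Real.smoothTransition.one_of_one_le (by norm_num)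
    have hy0 : y 1 = q.2 := by simp only [y, s1, s3]; ring
    have hx0 : x 1 = q.1 := by simp only [x, s2, hy0, hd, isoFst]; ring
    simp only [γ, hx0, hy0, s0]
    simp
  have eg : g 1 - g 0 = |d| + Real.cosh θ * |p₀.2.1| + Real.cosh θ * |q.2| + |k| := by
    have s0 : σ 1 = 1 := Real.smoothTransition.one
    have s1 : σ (3 * 1 - 0) = 1 := Real.smoothTransition.one_of_one_le (by norm_num)
    have s2 : σ (3 * 1 - 1) = 1 := Real.smoothTransition.one_of_one_le (by norm_num)
    have s3 : σ (3 * 1 - 2) = 1 := Real.smoothTransition.one_of_one_le (by norm_num)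
    have r0 : σ 0 = 0 := Real.smoothTransition.zero
    have r1 : σ (3 * 0 - 0) = 0 := Real.smoothTransition.zero_of_nonpos (by norm_num)
    have r2 : σ (3 * 0 - 1) = 0 := Real.smoothTransition.zero_of_nonpos (by norm_num)
    have r3 : σ (3 * 0 - 2) = 0 := Real.smoothTransition.zero_of_nonpos (by norm_num)
    simp only [g, s0, s1, s2, s3, r0, r1, r2, r3]
    ring
  rw [← eg, ← e1]
  nth_rw 1 [← e0]
  refine distIn_le_of_speed_le cγ cg (fun t _ => hS _ _) fun t => ?_
  rw [(hγ t).deriv, (hg t).deriv]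
  refine (sqrt_metric_add_vertical_le _ _ _ _ _).trans ?_
  rw [metric_fderiv_fmpSurface hτ]
  have hw := weight_ne_zero τ (y t)
  have hc := Real.cosh_pos θ
  have hxi : weight τ (y t) * (d * (3 * σ' (3 * t - 1)) -
      Real.sinh θ / (2 * τ) * (4 * τ ^ 2 * y t / weight τ (y t) * y' t)) +
      Real.sinh θ * (2 * τ * y t) * y' t = weight τ (y t) * (d * (3 * σ' (3 * t - 1))) := by
    field_simp
    ring
  -- Either ξ is stationary, or t lies in the middle third, where y = 0 and the conformal factor is
  -- 1.
  have h1 : weight τ (y t) * (d * (3 * σ' (3 * t - 1))) = d * (3 * σ' (3 * t - 1)) := by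
    rcases le_total (3 * t - 1) 0 with h | h
    · have : σ' (3 * t - 1) = 0 := deriv_smoothTransition_of_nonpos h
      simp [this]
    rcases le_total 1 (3 * t - 1) with h' | h'
    · have : σ' (3 * t - 1) = 0 := deriv_smoothTransition_of_one_le h'
      simp [this]
    · have s1 : σ (3 * t - 0) = 1 := Real.smoothTransition.one_of_one_le (by linarith)
      have s2 : σ (3 * t - 2) = 0 := Real.smoothTransition.zero_of_nonpos (by linarith)
      have : y t = 0 := by simp only [y, s1, s2]; ring
      rw [this, weight_zero, one_mul]
  have hy' : |y' t| ≤ |p₀.2.1| * (3 * σ' (3 * t - 0)) + |q.2| * (3 * σ' (3 * t - 2)) := by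
    refine (abs_add_le _ _).trans_eq ?_
    have n0 := hσn (3 * t - 0)
    have n2 := hσn (3 * t - 2)
    rw [abs_mul, abs_mul, abs_neg, abs_of_nonneg (by positivity : 0 ≤ 3 * σ' (3 * t - 0)),
      abs_of_nonneg (by positivity : 0 ≤ 3 * σ' (3 * t - 2))]
  have hm : |-σ' t * k| = |k| * σ' t := by
    rw [abs_mul, abs_neg, abs_of_nonneg (hσn t), mul_comm]
  have n1 := hσn (3 * t - 1)
  have hsq : Real.sqrt ((d * (3 * σ' (3 * t - 1))) * (d * (3 * σ' (3 * t - 1))) +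
      Real.cosh θ ^ 2 * (y' t * y' t)) ≤ |d| * (3 * σ' (3 * t - 1)) + Real.cosh θ * |y' t| := by
    refine Real.sqrt_le_iff.2 ⟨by positivity, ?_⟩
    have h2 : 0 ≤ |d| * (3 * σ' (3 * t - 1)) * (Real.cosh θ * |y' t|) := by positivity
    have h3 : (|d| * (3 * σ' (3 * t - 1))) ^ 2 = (d * (3 * σ' (3 * t - 1))) ^ 2 := by
      rw [mul_pow, sq_abs, ← mul_pow]
    have h4 : (Real.cosh θ * |y' t|) ^ 2 = (Real.cosh θ * y' t) ^ 2 := by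
      rw [mul_pow, sq_abs, mul_pow]
    rw [add_sq, h3, h4]
    nlinarith
  simp only [hxi, h1, hm]
  have := mul_le_mul_of_nonneg_left hy' hc.le
  linarith

/-! ### Area growth -/

theorem growthAtMost_area_ballIn {τ : ℝ} (hτ : τ ≠ 0) (θ : ℝ) (S : Set Pt) (p₀ : Pt) :
    GrowthAtMost (fun R => area τ (fmpSurface τ θ) (ballIn τ S p₀ R)) (fun R => R ^ 3) := by
  -- For R ≥ 1, |y| ≤ |y₀| + R ≤ (|y₀| + 1) R bounds the density by a multiple of R; the factor 4
  -- comes from the area 4R² of the square.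
  set K := Real.cosh θ * (1 + 2 * |τ| * (|p₀.2.1| + 1)) * 4
  have hc := Real.cosh_pos θ
  refine (limsup_le_of_le (h := ?_)).trans_lt (ENNReal.ofReal_lt_top (r := K))
  filter_upwards [eventually_ge_atTop 1] with R hR
  have hR0 : 0 < R := by linarith
  refine ENNReal.div_le_of_le_mul ?_
  have hsub : fmpSurface τ θ ⁻¹' ballIn τ S p₀ R ⊆
      Icc (p₀.1 - R) (p₀.1 + R) ×ˢ Icc (p₀.2.1 - R) (p₀.2.1 + R) := fun p hp => by
    obtain ⟨h1, h2⟩ := mem_box_of_mem_ballIn hp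
    simp only [fmpSurface, graphMap, abs_lt] at h1 h2
    exact ⟨⟨by linarith, by linarith⟩, ⟨by linarith, by linarith⟩⟩
  calc area τ (fmpSurface τ θ) (ballIn τ S p₀ R)
      ≤ ∫⁻ p in Icc (p₀.1 - R) (p₀.1 + R) ×ˢ Icc (p₀.2.1 - R) (p₀.2.1 + R),
          ENNReal.ofReal (areaDensity τ (fmpSurface τ θ) p) := lintegral_mono_set hsub
    _ ≤ ∫⁻ _ in Icc (p₀.1 - R) (p₀.1 + R) ×ˢ Icc (p₀.2.1 - R) (p₀.2.1 + R),
          ENNReal.ofReal (Real.cosh θ * (1 + 2 * |τ| * (|p₀.2.1| + 1)) * R) := by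
        refine setLIntegral_mono' (measurableSet_Icc.prod measurableSet_Icc) fun p hp => ?_
        refine ENNReal.ofReal_le_ofReal ?_
        rw [areaDensity_fmp hτ, mul_assoc]
        refine mul_le_mul_of_nonneg_left ((weight_le τ p.2).trans ?_) hc.le
        have h1 : |p.2| ≤ |p₀.2.1| + R := by
          have h2 : |p.2 - p₀.2.1| ≤ R := abs_le.2 ⟨by linarith [hp.2.1], by linarith [hp.2.2]⟩
          have h3 := abs_add_le p₀.2.1 (p.2 - p₀.2.1)
          rw [add_sub_cancel] at h3
          linarith
        have h4 : |p.2| ≤ (|p₀.2.1| + 1) * R := by nlinarith [abs_nonneg p₀.2.1]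
        have h5 := mul_le_mul_of_nonneg_left h4 (by positivity : 0 ≤ 2 * |τ|)
        linarith
    _ = ENNReal.ofReal K * ENNReal.ofReal (R ^ 3) := by
        rw [setLIntegral_const, Measure.volume_eq_prod, Measure.prod_prod, Real.volume_Icc,
          Real.volume_Icc, ← ENNReal.ofReal_mul (by linarith), ← ENNReal.ofReal_mul (by positivity),
          ← ENNReal.ofReal_mul (by positivity)]
        congr 1
        simp only [K]
        ring

theorem growthAtLeast_area_ballIn {τ : ℝ} (hτ : τ ≠ 0) (θ : ℝ) {S : Set Pt} (p₀ : Pt)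
    (hS : ∀ (p : ℝ × ℝ) (k : ℝ),
      fmpSurface τ θ p + (0, 0, k * (p₀.2.2 - fmp τ θ (p₀.1, p₀.2.1))) ∈ S) :
    GrowthAtLeast (fun R => area τ (fmpSurface τ θ) (ballIn τ S p₀ R)) (fun R => R ^ 3) := by
  have hc := Real.cosh_pos θ
  have hτ' := abs_pos.2 hτ
  set ξ₀ := isoFst τ θ (p₀.1, p₀.2.1) with hξ₀
  set k := p₀.2.2 - fmp τ θ (p₀.1, p₀.2.1) with hk
  -- The constant is the product of the density bound |τ|R/4 and the area bound (R/2) · R/(8 cosh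
  -- θ), divided by R³.
  refine (ENNReal.ofReal_pos.2 (by positivity : 0 < |τ| / (64 * Real.cosh θ))).trans_le
    (le_liminf_of_le (h := ?_))
  filter_upwards [eventually_gt_atTop 0,
    eventually_gt_atTop (4 * (Real.cosh θ * |p₀.2.1| + |k|))] with R hR0 hR
  let J : Set ℝ := Ioo (R / (8 * Real.cosh θ)) (R / (4 * Real.cosh θ))
  -- The change of ξ, the climb to y, and the fixed cost of leaving p₀ each take less than R/4.
  -- Keeping y above R/(8 cosh θ) makes the density of order R.
  let T : Set (ℝ × ℝ) := {p | p.2 ∈ J ∧ isoFst τ θ p ∈ Ioo (ξ₀ - R / 4) (ξ₀ + R / 4)}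
  have hiso : Continuous (isoFst τ θ) := by
    have := (contDiff_weight τ (n := 1)).continuous
    unfold isoFst
    fun_prop
  have hTm : MeasurableSet T :=
    ((isOpen_Ioo.preimage continuous_snd).inter (isOpen_Ioo.preimage hiso)).measurableSet
  have hvol : ENNReal.ofReal (R / 2) * ENNReal.ofReal (R / (8 * Real.cosh θ)) ≤ volume T := by
    rw [Measure.volume_eq_prod, Measure.prod_apply_symm hTm]
    refine le_trans ?_ (setLIntegral_le_lintegral J _)
    have h1 : volume J = ENNReal.ofReal (R / (8 * Real.cosh θ)) := by
      rw [Real.volume_Ioo]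
      congr 1
      field_simp
      ring
    rw [← h1, ← setLIntegral_const]
    refine setLIntegral_mono' measurableSet_Ioo fun y hy => ?_
    -- For fixed y, ξ is a translate of x, so every slice has length R/2.
    have h2 : (fun x => (x, y)) ⁻¹' T =
        Ioo (ξ₀ - R / 4 - Real.sinh θ / (2 * τ) * weight τ y)
          (ξ₀ + R / 4 - Real.sinh θ / (2 * τ) * weight τ y) := by
      ext x
      simp only [T, mem_preimage, mem_ofPred_eq, mem_Ioo, isoFst, hy, true_and]
      constructor <;> rintro ⟨_, _⟩ <;> constructor <;> linarith
    rw [h2, Real.volume_Ioo]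
    refine ENNReal.ofReal_le_ofReal (le_of_eq ?_)
    ring
  have hT : T ⊆ fmpSurface τ θ ⁻¹' ballIn τ S p₀ R := fun p hp => by
    refine ⟨by simpa [← Prod.zero_eq_mk] using hS p 0, (distIn_fmpSurface_le hτ θ p₀ p hS).trans_lt ?_⟩
    refine (ENNReal.ofReal_lt_ofReal_iff hR0).2 ?_
    have h0 : 0 < R / (8 * Real.cosh θ) := by positivity
    have h1 : |isoFst τ θ p - ξ₀| < R / 4 := abs_lt.2 ⟨by linarith [hp.2.1], by linarith [hp.2.2]⟩
    have h2 : Real.cosh θ * |p.2| < R / 4 := by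
      rw [abs_of_pos (h0.trans hp.1.1)]
      have := mul_lt_mul_of_pos_left hp.1.2 hc
      refine this.trans_eq ?_
      field_simp
    rw [← hξ₀, ← hk]
    linarith
  rw [ENNReal.le_div_iff_mul_le (Or.inl (ENNReal.ofReal_pos.2 (by positivity)).ne')
    (Or.inl ENNReal.ofReal_ne_top)]
  calc ENNReal.ofReal (|τ| / (64 * Real.cosh θ)) * ENNReal.ofReal (R ^ 3)
      = ENNReal.ofReal (|τ| * R / 4) *
          (ENNReal.ofReal (R / 2) * ENNReal.ofReal (R / (8 * Real.cosh θ))) := by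
        rw [← ENNReal.ofReal_mul (by positivity), ← ENNReal.ofReal_mul (by positivity),
          ← ENNReal.ofReal_mul (by positivity)]
        congr 1
        field_simp
        norm_num
    _ ≤ ENNReal.ofReal (|τ| * R / 4) * volume T := by gcongr
    _ = ∫⁻ _ in T, ENNReal.ofReal (|τ| * R / 4) := (setLIntegral_const _ _).symm
    _ ≤ ∫⁻ p in T, ENNReal.ofReal (areaDensity τ (fmpSurface τ θ) p) := by
        refine setLIntegral_mono' hTm fun p hp => ENNReal.ofReal_le_ofReal ?_
        rw [areaDensity_fmp hτ]
        have h0 : 0 < R / (8 * Real.cosh θ) := by positivity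
        have h1 := le_weight τ p.2
        rw [abs_of_pos (h0.trans hp.1.1)] at h1
        have h2 := mul_le_mul_of_nonneg_left hp.1.1.le (by positivity : 0 ≤ 2 * |τ|)
        have h3 := mul_le_mul_of_nonneg_left (h2.trans h1) hc.le
        refine le_trans (le_of_eq ?_) h3
        field_simp
        norm_num
    _ ≤ area τ (fmpSurface τ θ) (ballIn τ S p₀ R) := lintegral_mono_set hT

theorem cubicGrowth_extrinsicArea_fmp {τ : ℝ} (hτ : τ ≠ 0) (θ : ℝ) (p₀ : Pt) :
    CubicGrowth (extrinsicArea τ (fmpSurface τ θ) p₀) :=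
  ⟨growthAtLeast_area_ballIn hτ θ p₀ fun _ _ => mem_univ _, growthAtMost_area_ballIn hτ θ _ p₀⟩

theorem cubicGrowth_intrinsicArea_fmp {τ : ℝ} (hτ : τ ≠ 0) (θ : ℝ) {p₀ : Pt}
    (hp₀ : p₀ ∈ range (fmpSurface τ θ)) : CubicGrowth (intrinsicArea τ (fmpSurface τ θ) p₀) := by
  refine ⟨growthAtLeast_area_ballIn hτ θ p₀ fun p k => ?_, growthAtMost_area_ballIn hτ θ _ p₀⟩
  obtain ⟨q, rfl⟩ := hp₀
  -- The height of p₀ over Σ_θ is zero, so the path never leaves the surface.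
  exact ⟨p, by simp [fmpSurface, graphMap]⟩

end HeisenbergGraphs

theorem mainTheorem6 (τ : ℝ) (hτ : τ ≠ 0) (θ : ℝ) :
    HeisenbergGraphs.IsMinimalGraph τ (HeisenbergGraphs.fmp τ θ) ∧
    (∀ p₀ : HeisenbergGraphs.Pt, HeisenbergGraphs.CubicGrowth
      (HeisenbergGraphs.extrinsicArea τ (HeisenbergGraphs.fmpSurface τ θ) p₀)) ∧
    (∀ p₀ ∈ Set.range (HeisenbergGraphs.fmpSurface τ θ), HeisenbergGraphs.CubicGrowth
      (HeisenbergGraphs.intrinsicArea τ (HeisenbergGraphs.fmpSurface τ θ) p₀)) ∧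
    HeisenbergGraphs.IsConformalToPlane τ (Set.range (HeisenbergGraphs.fmpSurface τ θ)) ∧
    HeisenbergGraphs.IsParabolic τ (HeisenbergGraphs.fmpSurface τ θ) := by
  exact ⟨HeisenbergGraphs.isMinimalGraph_fmp hτ θ,
    HeisenbergGraphs.cubicGrowth_extrinsicArea_fmp hτ θ,
    fun _ h => HeisenbergGraphs.cubicGrowth_intrinsicArea_fmp hτ θ h,
    HeisenbergGraphs.isConformalToPlane_fmp hτ θ, HeisenbergGraphs.isParabolic_fmp hτ θ⟩
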